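/- Let $M_n$ denote the space of real $n\times n$ matrices, and let $$\mathcal K=\{(\xi,\eta):\ \xi\in\mathbb R^{2},\ \eta\in\mathbb R,\ \|\xi\|_2\le \eta\}\subset\mathbb R^3$$ be the Lorentz cone. The Lorentz spectrum $\sigma_L(A)$ of $A\in M_3$ is the set of all $\lambda\in\mathbb R$ for which there is a nonzero $x\in\mathbb R^3$ such that $$x\in\mathcal K,\qquad (A-\lambda I)x\in\mathcal K,\qquad x^T(A-\lambda I)x=0 .$$ Theorem. Let $\varphi:M_3\to M_3$ be a linear map. Then $\sigma_L(\varphi(A))=\sigma_L(A)$ for all $A\in M_3$ if and only if there exists an orthogonal matrix $Q\in M_2$ such that $$\varphi(A)=\begin{bmatrix}Q&0\\0&1\end{bmatrix}A\begin{bmatrix}Q^T&0\\0&1\end{bmatrix}\qquad\text{for all }A\in M_3 .$$ -/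

import Mathlib

/-- The Lorentz cone `{(ξ, η) : ξ ∈ ℝⁿ, η ∈ ℝ, ‖ξ‖₂ ≤ η}` in `ℝⁿ⁺¹` (the last coordinate is `η`,
and the norm is the Euclidean one). -/
def lorentzCone (n : ℕ) : Set (Fin (n + 1) → ℝ) :=
  {x | ‖WithLp.toLp 2 (fun i : Fin n => x i.castSucc)‖ ≤ x (Fin.last n)}

/-- `x` is a Lorentz eigenvector of `A` with associated Lorentz eigenvalue `μ`. -/
def IsLorentzEigenpair {n : ℕ} (A : Matrix (Fin (n + 1)) (Fin (n + 1)) ℝ)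
    (μ : ℝ) (x : Fin (n + 1) → ℝ) : Prop :=
  x ≠ 0 ∧ x ∈ lorentzCone n ∧ Matrix.mulVec (A - μ • 1) x ∈ lorentzCone n ∧
    x ⬝ᵥ Matrix.mulVec (A - μ • 1) x = 0

/-- The Lorentz spectrum of `A`: the set of all its Lorentz eigenvalues. -/
def lorentzSpectrum {n : ℕ} (A : Matrix (Fin (n + 1)) (Fin (n + 1)) ℝ) : Set ℝ :=
  {μ | ∃ x : Fin (n + 1) → ℝ, IsLorentzEigenpair A μ x}

/-- `φ` is a linear preserver of the Lorentz spectrum. -/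
def PreservesLorentzSpectrum {n : ℕ}
    (φ : Matrix (Fin (n + 1)) (Fin (n + 1)) ℝ →ₗ[ℝ] Matrix (Fin (n + 1)) (Fin (n + 1)) ℝ) : Prop :=
  ∀ A, lorentzSpectrum (φ A) = lorentzSpectrum A

/-- The block diagonal matrix `Q ⊕ [1]`, with `1` as its last diagonal entry. -/
def directSumOne {n : ℕ} (Q : Matrix (Fin n) (Fin n) ℝ) :
    Matrix (Fin (n + 1)) (Fin (n + 1)) ℝ :=
  Matrix.reindex finSumFinEquiv finSumFinEquiv
    (Matrix.fromBlocks Q 0 0 (1 : Matrix (Fin 1) (Fin 1) ℝ))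

/-!
Write `A = [B, u; vᵀ, d]` with `B` the upper left block. A nonzero vector of the cone can be scaled
to `(ξ, 1)`, and `μ` is a Lorentz eigenvalue of `A` exactly when `B ξ + u = (μ - s) ξ` and
`v ⬝ ξ + d = μ + s` for some `‖ξ‖ ≤ 1` and `s ≥ 0`, where `s = 0` if `‖ξ‖ < 1`
(`mem_lorentzSpectrum_iff`). This description is invariant under conjugation by `Q ⊕ 1` with `Q`
orthogonal, which is the easy direction. For the converse let `φ` preserve the spectrum.

* The spectrum can be infinite only if infinitely many unit vectors `ξ` satisfy
  `B ξ + u ∈ ℝ ξ`, which in dimension two forces `B = b I` and `u = 0`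
  (`eq_bordered_of_infinite_lorentzSpectrum`). The spectra of the matrices `[b I, 0; vᵀ, d]` are
  explicit (`mem_lorentzSpectrum_bordered_iff`), and comparing them shows that `φ` acts on the
  matrices `[0, 0; vᵀ, 0]` through an orthogonal map `v ↦ Q v` and fixes the corner matrix
  `E = [0, 0; 0, 1]`. After conjugation by `Qᵀ ⊕ 1`, all matrices `[0, 0; vᵀ, 0]` are fixed.

* For large `r`, put `ξ = (r - B)⁻¹ u`, a short vector. Then `r` is an eigenvalue of `A + t E` for
  `t = r - d - v ⬝ ξ`. The same `r` and `t` must work for `φ A = [B', u'; v'ᵀ, d']`, so the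
  functions `d + v ⬝ (r - B)⁻¹ u` of `r` agree for `A` and `φ A`. Their expansions in `1 / r` show
  that `d` and all the numbers `v ⬝ Bᵏ u` are preserved
  (`markov_eq_of_lorentzSpectrum_subset`).

* Adding matrices `[0, 0; wᵀ, 0]` to `A` makes `v` arbitrary, so that `Bᵏ u = B'ᵏ u'` and
  `v ⬝ Bᵏ u = v' ⬝ Bᵏ u` for all `k`. If `u` and `B u` are linearly independent, this gives
  `φ A = A` (`map_eq_self_of_cyclic`), and such matrices span the whole space.
-/

open Filter Topology

/-! ### Lorentz eigenvalues in block form -/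

section Blocks

variable {n : ℕ}

/-- The block `B` of `A = [B, u; vᵀ, d]`. -/
def blockB (A : Matrix (Fin (n + 1)) (Fin (n + 1)) ℝ) : Matrix (Fin n) (Fin n) ℝ :=
  A.submatrix Fin.castSucc Fin.castSucc

/-- The column `u` of `A = [B, u; vᵀ, d]`. -/
def blockU (A : Matrix (Fin (n + 1)) (Fin (n + 1)) ℝ) : Fin n → ℝ :=
  fun i => A i.castSucc (Fin.last n)

/-- The row `v` of `A = [B, u; vᵀ, d]`. -/
def blockV (A : Matrix (Fin (n + 1)) (Fin (n + 1)) ℝ) : Fin n → ℝ :=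
  fun j => A (Fin.last n) j.castSucc

theorem mem_lorentzCone_iff (x : Fin (n + 1) → ℝ) :
    x ∈ lorentzCone n ↔
      0 ≤ x (Fin.last n) ∧ (∑ i : Fin n, x i.castSucc ^ 2) ≤ x (Fin.last n) ^ 2 := by
  rw [lorentzCone, Set.mem_ofPred_eq, EuclideanSpace.norm_eq, Real.sqrt_le_iff]
  simp

theorem mulVec_castSucc (A : Matrix (Fin (n + 1)) (Fin (n + 1)) ℝ) (μ : ℝ)
    (x : Fin (n + 1) → ℝ) (i : Fin n) :
    Matrix.mulVec (A - μ • 1) x i.castSucc =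
      (blockB A).mulVec (fun j => x j.castSucc) i + blockU A i * x (Fin.last n)
        - μ * x i.castSucc := by
  rw [Matrix.sub_mulVec, Matrix.smul_mulVec, Matrix.one_mulVec]
  simp [Matrix.mulVec, dotProduct, Fin.sum_univ_castSucc, blockB, blockU]

theorem mulVec_last (A : Matrix (Fin (n + 1)) (Fin (n + 1)) ℝ) (μ : ℝ)
    (x : Fin (n + 1) → ℝ) :
    Matrix.mulVec (A - μ • 1) x (Fin.last n) =
      blockV A ⬝ᵥ (fun j => x j.castSucc) + A (Fin.last n) (Fin.last n) * x (Fin.last n)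
        - μ * x (Fin.last n) := by
  rw [Matrix.sub_mulVec, Matrix.smul_mulVec, Matrix.one_mulVec]
  simp [Matrix.mulVec, dotProduct, Fin.sum_univ_castSucc, blockV]

/-- A Lorentz eigenvector may be scaled to `x = (ξ, 1)`, and then `(A - μ I) x` is the multiple
`s (-ξ, 1)` of the reflected vector, with `s = 0` unless `x` is on the boundary of the cone. -/
theorem mem_lorentzSpectrum_iff (A : Matrix (Fin (n + 1)) (Fin (n + 1)) ℝ) (μ : ℝ) :
    μ ∈ lorentzSpectrum A ↔ ∃ (ξ : Fin n → ℝ) (s : ℝ), ξ ⬝ᵥ ξ ≤ 1 ∧ 0 ≤ s ∧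
      s * (1 - ξ ⬝ᵥ ξ) = 0 ∧ (blockB A).mulVec ξ + blockU A = (μ - s) • ξ ∧
      blockV A ⬝ᵥ ξ + A (Fin.last n) (Fin.last n) = μ + s := by
  constructor
  · rintro ⟨x, hx0, hx, hy, hxy⟩
    rw [mem_lorentzCone_iff] at hx hy
    obtain ⟨hx1, hx2⟩ := hx
    obtain ⟨hy1, hy2⟩ := hy
    set z := x (Fin.last n) with hz
    have hzpos : 0 < z := by
      rcases hx1.lt_or_eq with h | h
      · exact h
      · exfalso
        apply hx0
        rw [← h] at hx2
        have h0 : ∀ i : Fin n, x i.castSucc = 0 := by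
          have h1 : (∑ i : Fin n, x i.castSucc ^ 2) = 0 :=
            le_antisymm (by simpa using hx2) (Finset.sum_nonneg fun i _ => sq_nonneg _)
          intro i
          rw [Finset.sum_eq_zero_iff_of_nonneg (fun i _ => sq_nonneg _)] at h1
          simpa using h1 i (Finset.mem_univ i)
        funext i
        refine Fin.lastCases ?_ (fun i => ?_) i
        · rw [← hz, ← h]; rfl
        · simpa using h0 i
    set y := Matrix.mulVec (A - μ • 1) x with hy
    set s := y (Fin.last n) with hs
    have hxy' : ∑ i : Fin n, x i.castSucc * y i.castSucc + z * s = 0 := by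
      simpa [dotProduct, Fin.sum_univ_castSucc] using hxy
    -- Orthogonality to `x` leaves no room: the sum of squares of `z y' + s x'` is nonpositive.
    have hsum : ∑ i : Fin n, (z * y i.castSucc + s * x i.castSucc) ^ 2
        = z ^ 2 * (∑ i : Fin n, y i.castSucc ^ 2) + s ^ 2 * (∑ i : Fin n, x i.castSucc ^ 2)
          - 2 * z ^ 2 * s ^ 2 := by
      have : ∑ i : Fin n, (z * y i.castSucc + s * x i.castSucc) ^ 2
        = z ^ 2 * (∑ i : Fin n, y i.castSucc ^ 2) + s ^ 2 * (∑ i : Fin n, x i.castSucc ^ 2)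
          + 2 * z * s * ∑ i : Fin n, x i.castSucc * y i.castSucc := by
        simp only [Finset.mul_sum, ← Finset.sum_add_distrib]
        exact Finset.sum_congr rfl fun i _ => by ring
      rw [this]
      linear_combination 2 * z * s * hxy'
    have hnn : 0 ≤ ∑ i : Fin n, (z * y i.castSucc + s * x i.castSucc) ^ 2 :=
      Finset.sum_nonneg fun i _ => sq_nonneg _
    have e1 : z ^ 2 * (∑ i : Fin n, y i.castSucc ^ 2) ≤ z ^ 2 * s ^ 2 :=
      mul_le_mul_of_nonneg_left hy2 (sq_nonneg _)
    have e2 : s ^ 2 * (∑ i : Fin n, x i.castSucc ^ 2) ≤ s ^ 2 * z ^ 2 :=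
      mul_le_mul_of_nonneg_left hx2 (sq_nonneg _)
    have hzero : ∀ i : Fin n, z * y i.castSucc + s * x i.castSucc = 0 := by
      have h1 : ∑ i : Fin n, (z * y i.castSucc + s * x i.castSucc) ^ 2 = 0 :=
        le_antisymm (by linarith) hnn
      intro i
      rw [Finset.sum_eq_zero_iff_of_nonneg (fun i _ => sq_nonneg _)] at h1
      simpa using h1 i (Finset.mem_univ i)
    have e3 : s ^ 2 * (∑ i : Fin n, x i.castSucc ^ 2) = s ^ 2 * z ^ 2 := by linarith
    have hdot : (z⁻¹ • fun i : Fin n => x i.castSucc) ⬝ᵥ (z⁻¹ • fun i : Fin n => x i.castSucc)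
        = (∑ i : Fin n, x i.castSucc ^ 2) / z ^ 2 := by
      simp only [dotProduct, Pi.smul_apply, smul_eq_mul, Finset.sum_div]
      exact Finset.sum_congr rfl fun i _ => by field_simp
    refine ⟨z⁻¹ • fun i => x i.castSucc, s / z, ?_, div_nonneg hy1 hzpos.le, ?_, ?_, ?_⟩
    · rw [hdot]
      exact div_le_one_of_le₀ hx2 (sq_nonneg _)
    · rw [hdot]
      rcases eq_or_ne s 0 with h | h
      · simp [h]
      · have : (∑ i : Fin n, x i.castSucc ^ 2) = z ^ 2 :=
          mul_left_cancel₀ (pow_ne_zero 2 h) e3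
        rw [this, div_self (pow_ne_zero 2 hzpos.ne')]
        simp
    · funext i
      have h1 := mulVec_castSucc A μ x i
      have h2 := hzero i
      rw [Matrix.mulVec_smul]
      simp only [Pi.add_apply, Pi.smul_apply, smul_eq_mul]
      rw [← hy, ← hz] at h1
      field_simp
      linear_combination h2 - z * h1
    · have h1 := mulVec_last A μ x
      rw [dotProduct_smul, smul_eq_mul]
      rw [← hy, ← hs, ← hz] at h1
      field_simp
      linear_combination -h1
  · rintro ⟨ξ, s, h1, h2, h3, h4, h5⟩
    set x : Fin (n + 1) → ℝ := Fin.snoc ξ 1 with hx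
    have hxl : x (Fin.last n) = 1 := by simp [hx]
    have hxc : ∀ i : Fin n, x i.castSucc = ξ i := by simp [hx]
    have hxc' : (fun i : Fin n => x i.castSucc) = ξ := funext hxc
    have hyc : ∀ i : Fin n, Matrix.mulVec (A - μ • 1) x i.castSucc = - s * ξ i := by
      intro i
      rw [mulVec_castSucc, hxc', hxl, hxc]
      have := congrFun h4 i
      simp only [Pi.add_apply, Pi.smul_apply, smul_eq_mul] at this
      linarith
    have hyl : Matrix.mulVec (A - μ • 1) x (Fin.last n) = s := by
      rw [mulVec_last, hxc', hxl]
      linarith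
    have hsq : ∑ i : Fin n, ξ i ^ 2 = ξ ⬝ᵥ ξ := by
      simp [dotProduct, sq]
    refine ⟨x, ?_, ?_, ?_, ?_⟩
    · intro h
      have := congrFun h (Fin.last n)
      rw [hxl] at this
      simp at this
    · rw [mem_lorentzCone_iff]
      simp only [hxl, hxc, hsq]
      exact ⟨zero_le_one, by simpa using h1⟩
    · rw [mem_lorentzCone_iff]
      simp only [hyl, hyc, mul_pow, ← Finset.mul_sum, hsq]
      exact ⟨h2, by nlinarith [sq_nonneg s]⟩
    · have : x ⬝ᵥ Matrix.mulVec (A - μ • 1) x = ∑ i : Fin n, ξ i * (-s * ξ i) + s := by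
        simp only [dotProduct, Fin.sum_univ_castSucc, hyl, hyc, hxl, hxc, one_mul]
      have h6 : ∑ i : Fin n, ξ i * (-s * ξ i) = - s * (ξ ⬝ᵥ ξ) := by
        simp only [dotProduct, Finset.mul_sum]
        exact Finset.sum_congr rfl fun i _ => by ring
      rw [this, h6]
      linarith

end Blocks

/-! ### Large eigenvalues and Markov parameters -/

section Markov
variable {n : ℕ}

theorem isCompact_dotProduct_self_le_one : IsCompact {ξ : Fin n → ℝ | ξ ⬝ᵥ ξ ≤ 1} := by
  refine (isCompact_closedBall (0 : Fin n → ℝ) 1).of_isClosed_subset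
    (isClosed_le (by unfold dotProduct; fun_prop) continuous_const) fun ξ hξ => ?_
  rw [mem_closedBall_zero_iff, pi_norm_le_iff_of_nonneg zero_le_one]
  intro i
  have h1 : ξ i * ξ i ≤ ξ ⬝ᵥ ξ :=
    Finset.single_le_sum (f := fun i => ξ i * ξ i) (fun i _ => mul_self_nonneg _)
      (Finset.mem_univ i)
  have h2 : ξ i * ξ i ≤ 1 := h1.trans hξ
  rw [Real.norm_eq_abs]
  exact abs_le_one_iff_mul_self_le_one.2 h2

/-- For large `r` the equation `B ξ + u = r ξ` has a solution `ξ = r⁻¹ (1 - r⁻¹ B)⁻¹ u`,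
which tends to zero. -/
theorem exists_tendsto_resolvent (B : Matrix (Fin n) (Fin n) ℝ) (u : Fin n → ℝ) :
    ∃ ξ : ℝ → Fin n → ℝ, (∀ᶠ r in atTop, B.mulVec (ξ r) + u = r • ξ r) ∧
      Tendsto ξ atTop (𝓝 0) := by
  have hdet : ContinuousAt (fun t : ℝ => (1 - t • B).det) 0 := by
    apply Continuous.continuousAt
    apply Continuous.matrix_det
    fun_prop
  have hadj : ContinuousAt (fun t : ℝ => (1 - t • B).adjugate) 0 := by
    apply Continuous.continuousAt
    apply Continuous.matrix_adjugate
    fun_prop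
  have h0 : (1 - (0 : ℝ) • B).det ≠ 0 := by simp
  refine ⟨fun r => r⁻¹ • (((1 - r⁻¹ • B).det)⁻¹ • ((1 - r⁻¹ • B).adjugate.mulVec u)), ?_, ?_⟩
  · have h1 : ∀ᶠ r : ℝ in atTop, (1 - r⁻¹ • B).det ≠ 0 :=
      tendsto_inv_atTop_zero.eventually (hdet.eventually_ne h0)
    filter_upwards [h1, eventually_gt_atTop 0] with r hr hr0
    set w := ((1 - r⁻¹ • B).det)⁻¹ • ((1 - r⁻¹ • B).adjugate.mulVec u) with hw
    have hw1 : (1 - r⁻¹ • B).mulVec w = u := by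
      rw [hw, Matrix.mulVec_smul, Matrix.mulVec_mulVec, Matrix.mul_adjugate, Matrix.smul_mulVec,
        Matrix.one_mulVec, smul_smul, inv_mul_cancel₀ hr, one_smul]
    rw [Matrix.sub_mulVec, Matrix.one_mulVec, Matrix.smul_mulVec] at hw1
    rw [Matrix.mulVec_smul, smul_smul, mul_inv_cancel₀ hr0.ne', one_smul, ← hw1]
    abel
  · have h2 : ContinuousAt
        (fun t : ℝ => t • (((1 - t • B).det)⁻¹ • ((1 - t • B).adjugate.mulVec u))) 0 := by
      refine continuousAt_id.smul ((hdet.inv₀ h0).smul ?_)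
      exact (Continuous.matrix_mulVec continuous_id continuous_const).continuousAt.comp hadj
    have h3 := h2.tendsto.comp tendsto_inv_atTop_zero
    simpa [Function.comp_def] using h3

/-- `r ξ` is bounded because `ξ` is. -/
theorem tendsto_zero_of_mulVec_add_eq_smul {B : Matrix (Fin n) (Fin n) ℝ} {u : Fin n → ℝ}
    {ξ : ℝ → Fin n → ℝ} (hb : ∀ᶠ r in atTop, ξ r ⬝ᵥ ξ r ≤ 1)
    (h : ∀ᶠ r in atTop, B.mulVec (ξ r) + u = r • ξ r) : Tendsto ξ atTop (𝓝 0) := by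
  obtain ⟨C, hC⟩ := isCompact_dotProduct_self_le_one.exists_bound_of_continuousOn
    (f := fun ξ : Fin n → ℝ => B.mulVec ξ + u) (by fun_prop)
  rw [tendsto_zero_iff_norm_tendsto_zero]
  have hlim : Tendsto (fun r : ℝ => r⁻¹ * C) atTop (𝓝 0) := by
    simpa using tendsto_inv_atTop_zero.mul_const C
  refine tendsto_of_tendsto_of_tendsto_of_le_of_le' tendsto_const_nhds hlim
    (Eventually.of_forall fun _ => norm_nonneg _) ?_
  filter_upwards [hb, h, eventually_gt_atTop 0] with r h1 h2 h3
  have h4 := hC _ h1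
  simp only [h2, norm_smul, Real.norm_eq_abs, abs_of_pos h3] at h4
  rw [inv_mul_eq_div, le_div_iff₀' h3]
  exact h4

/-- Two transfer functions `v ⬝ (r - B)⁻¹ u` that agree for large `r`, up to a constant, have the
same Markov parameters `v ⬝ Bᵏ u`, and the constant is zero. -/
theorem dotProduct_pow_mulVec_eq {B B' : Matrix (Fin n) (Fin n) ℝ} {u u' v v' : Fin n → ℝ}
    {c : ℝ} {ξ ξ' : ℝ → Fin n → ℝ} (hξ : Tendsto ξ atTop (𝓝 0)) (hξ' : Tendsto ξ' atTop (𝓝 0))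
    (h : ∀ᶠ r in atTop, B.mulVec (ξ r) + u = r • ξ r)
    (h' : ∀ᶠ r in atTop, B'.mulVec (ξ' r) + u' = r • ξ' r)
    (hc : ∀ᶠ r in atTop, v ⬝ᵥ ξ r = v' ⬝ᵥ ξ' r + c) :
    c = 0 ∧ ∀ k : ℕ, v ⬝ᵥ (B ^ k).mulVec u = v' ⬝ᵥ (B' ^ k).mulVec u' := by
  have hlim : ∀ (B : Matrix (Fin n) (Fin n) ℝ) (v : Fin n → ℝ) (ξ : ℝ → Fin n → ℝ) (k : ℕ),
      Tendsto ξ atTop (𝓝 0) → Tendsto (fun r => v ⬝ᵥ (B ^ k).mulVec (ξ r)) atTop (𝓝 0) := by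
    intro B v ξ k hξ
    have hcont : Continuous fun x : Fin n → ℝ => v ⬝ᵥ (B ^ k).mulVec x :=
      continuous_const.dotProduct (continuous_const.matrix_mulVec continuous_id)
    simpa [Function.comp_def] using (hcont.tendsto 0).comp hξ
  -- A constant difference of two functions tending to zero vanishes.
  have hconst : ∀ (k : ℕ) (m : ℝ), (∀ᶠ r in atTop,
      v ⬝ᵥ (B ^ k).mulVec (ξ r) = v' ⬝ᵥ (B' ^ k).mulVec (ξ' r) + m) → m = 0 := by
    intro k m hm
    have h1 : Tendsto (fun _ : ℝ => m) atTop (𝓝 (0 - 0)) := by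
      refine ((hlim B v ξ k hξ).sub (hlim B' v' ξ' k hξ')).congr' ?_
      filter_upwards [hm] with r hr
      rw [hr]; ring
    rw [sub_zero] at h1
    exact tendsto_nhds_unique tendsto_const_nhds h1
  have hrec : ∀ {B : Matrix (Fin n) (Fin n) ℝ} {v u x : Fin n → ℝ} {r : ℝ} (k : ℕ),
      B.mulVec x + u = r • x →
      v ⬝ᵥ (B ^ (k + 1)).mulVec x + v ⬝ᵥ (B ^ k).mulVec u = r * v ⬝ᵥ (B ^ k).mulVec x := by
    intro B v u x r k hx
    rw [← dotProduct_add, pow_succ, ← Matrix.mulVec_mulVec, ← Matrix.mulVec_add, hx,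
      Matrix.mulVec_smul, dotProduct_smul, smul_eq_mul]
  have hc0 : c = 0 := hconst 0 c (by simpa using hc)
  subst hc0
  have hstep : ∀ k : ℕ, (∀ᶠ r in atTop,
      v ⬝ᵥ (B ^ k).mulVec (ξ r) = v' ⬝ᵥ (B' ^ k).mulVec (ξ' r)) →
      v ⬝ᵥ (B ^ k).mulVec u = v' ⬝ᵥ (B' ^ k).mulVec u' ∧ ∀ᶠ r in atTop,
        v ⬝ᵥ (B ^ (k + 1)).mulVec (ξ r) = v' ⬝ᵥ (B' ^ (k + 1)).mulVec (ξ' r) := by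
    intro k hk
    have h1 : ∀ᶠ r in atTop, v ⬝ᵥ (B ^ (k + 1)).mulVec (ξ r) =
        v' ⬝ᵥ (B' ^ (k + 1)).mulVec (ξ' r) +
          (v' ⬝ᵥ (B' ^ k).mulVec u' - v ⬝ᵥ (B ^ k).mulVec u) := by
      filter_upwards [h, h', hk] with r hr hr' hkr
      have e1 := hrec (v := v) k hr
      have e2 := hrec (v := v') k hr'
      rw [hkr] at e1
      linarith
    have h2 := hconst (k + 1) _ h1
    refine ⟨by linarith, ?_⟩
    filter_upwards [h1] with r hr
    rw [hr, h2, add_zero]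
  have hall : ∀ k : ℕ, ∀ᶠ r in atTop,
      v ⬝ᵥ (B ^ k).mulVec (ξ r) = v' ⬝ᵥ (B' ^ k).mulVec (ξ' r) := by
    intro k
    induction k with
    | zero => simpa using hc
    | succ k ih => exact (hstep k ih).2
  exact ⟨rfl, fun k => (hstep k (hall k)).1⟩

/-- For large `r` one can choose `t` such that `r` is an eigenvalue of `A + t E`, with an eigenvector
inside the cone; boundary eigenvectors of `A' + t E` only give Lorentz eigenvalues close to `t / 2`,
so `r` is an eigenvalue of `A' + t E` as well. -/
theorem markov_eq_of_lorentzSpectrum_subset {A A' : Matrix (Fin (n + 1)) (Fin (n + 1)) ℝ}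
    (h : ∀ t : ℝ, lorentzSpectrum (A + t • Matrix.single (Fin.last n) (Fin.last n) 1) ⊆
      lorentzSpectrum (A' + t • Matrix.single (Fin.last n) (Fin.last n) 1)) :
    A (Fin.last n) (Fin.last n) = A' (Fin.last n) (Fin.last n) ∧
    ∀ k : ℕ, blockV A ⬝ᵥ (blockB A ^ k).mulVec (blockU A) =
      blockV A' ⬝ᵥ (blockB A' ^ k).mulVec (blockU A') := by
  have hB : ∀ (A : Matrix (Fin (n + 1)) (Fin (n + 1)) ℝ) (t : ℝ),
      blockB (A + t • Matrix.single (Fin.last n) (Fin.last n) 1) = blockB A := by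
    intro A t; ext i j; simp [blockB, (Fin.castSucc_lt_last _).ne']
  have hU : ∀ (A : Matrix (Fin (n + 1)) (Fin (n + 1)) ℝ) (t : ℝ),
      blockU (A + t • Matrix.single (Fin.last n) (Fin.last n) 1) = blockU A := by
    intro A t; ext i; simp [blockU, (Fin.castSucc_lt_last _).ne']
  have hV : ∀ (A : Matrix (Fin (n + 1)) (Fin (n + 1)) ℝ) (t : ℝ),
      blockV (A + t • Matrix.single (Fin.last n) (Fin.last n) 1) = blockV A := by
    intro A t; ext i; simp [blockV, (Fin.castSucc_lt_last _).ne']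
  have hD : ∀ (A : Matrix (Fin (n + 1)) (Fin (n + 1)) ℝ) (t : ℝ),
      (A + t • Matrix.single (Fin.last n) (Fin.last n) 1 :
        Matrix (Fin (n + 1)) (Fin (n + 1)) ℝ) (Fin.last n) (Fin.last n) =
        A (Fin.last n) (Fin.last n) + t := by
    intro A t; simp
  obtain ⟨ξ, hξ, hξ0⟩ := exists_tendsto_resolvent (blockB A) (blockU A)
  have hdotc : Continuous fun x : Fin n → ℝ => x ⬝ᵥ x := continuous_id.dotProduct continuous_id
  have hξ1 : ∀ᶠ r in atTop, ξ r ⬝ᵥ ξ r ≤ 1 := by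
    have h1 : Tendsto (fun r => ξ r ⬝ᵥ ξ r) atTop (𝓝 0) := by
      simpa [Function.comp_def] using (hdotc.tendsto 0).comp hξ0
    exact (h1.eventually (gt_mem_nhds zero_lt_one)).mono fun r hr => le_of_lt hr
  obtain ⟨C₁, hC₁⟩ := (isCompact_dotProduct_self_le_one (n := n)).exists_bound_of_continuousOn
    (f := fun ξ : Fin n → ℝ => blockV A ⬝ᵥ ξ)
    (continuous_const.dotProduct continuous_id).continuousOn
  obtain ⟨C₂, hC₂⟩ := (isCompact_dotProduct_self_le_one (n := n)).exists_bound_of_continuousOn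
    (f := fun ξ : Fin n → ℝ => blockV A' ⬝ᵥ ξ)
    (continuous_const.dotProduct continuous_id).continuousOn
  obtain ⟨C₃, hC₃⟩ := (isCompact_dotProduct_self_le_one (n := n)).exists_bound_of_continuousOn
    (f := fun ξ : Fin n → ℝ => ξ ⬝ᵥ ((blockB A').mulVec ξ + blockU A'))
    (continuous_id.dotProduct ((continuous_const.matrix_mulVec continuous_id).add
      continuous_const)).continuousOn
  set d := A (Fin.last n) (Fin.last n)
  set d' := A' (Fin.last n) (Fin.last n)
  have hex : ∀ᶠ r : ℝ in atTop, ∃ x : Fin n → ℝ, x ⬝ᵥ x ≤ 1 ∧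
      (blockB A').mulVec x + blockU A' = r • x ∧
      blockV A ⬝ᵥ ξ r = blockV A' ⬝ᵥ x + (d' - d) := by
    filter_upwards [hξ, hξ1, eventually_gt_atTop (C₁ + C₂ + C₃ + |d' - d|)] with r h1 h2 h3
    have hr : r ∈ lorentzSpectrum
        (A + (r - blockV A ⬝ᵥ ξ r - d) • Matrix.single (Fin.last n) (Fin.last n) 1) := by
      rw [mem_lorentzSpectrum_iff, hB, hU, hV, hD]
      exact ⟨ξ r, 0, h2, le_rfl, zero_mul _, by rw [sub_zero, h1], by ring⟩
    replace hr := h _ hr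
    rw [mem_lorentzSpectrum_iff, hB, hU, hV, hD] at hr
    obtain ⟨x, s, hx1, -, hx3, hx4, hx5⟩ := hr
    have hs : s = 0 := by
      by_contra hs
      have hx6 : x ⬝ᵥ x = 1 := by
        have := (mul_eq_zero.1 hx3).resolve_left hs
        linarith
      have e1 := abs_le.1 (hC₁ _ h2)
      have e2 := abs_le.1 (hC₂ _ hx1)
      have e3 := hC₃ _ hx1
      simp only [hx4, dotProduct_smul, hx6, smul_eq_mul, mul_one] at e3
      have e3 := abs_le.1 e3
      have e4 := le_abs_self (d' - d)
      change _ + (d' + _) = _ at hx5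
      linarith [e1.1, e1.2, e2.1, e2.2, e3.1, e3.2]
    subst hs
    rw [sub_zero] at hx4
    exact ⟨x, hx1, hx4, by change _ + (d' + _) = _ at hx5; linarith⟩
  obtain ⟨ξ', hξ'⟩ := hex.choice
  have hξ'0 := tendsto_zero_of_mulVec_add_eq_smul (hξ'.mono fun r hr => hr.1)
    (hξ'.mono fun r hr => hr.2.1)
  obtain ⟨h1, h2⟩ := dotProduct_pow_mulVec_eq hξ0 hξ'0 hξ (hξ'.mono fun r hr => hr.2.1)
    (hξ'.mono fun r hr => hr.2.2)
  exact ⟨by linarith, h2⟩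

end Markov

/-! ### Conjugation by orthogonal matrices -/

section Conjugation
variable {n : ℕ}

theorem directSumOne_castSucc_castSucc (Q : Matrix (Fin n) (Fin n) ℝ) (i j : Fin n) :
    directSumOne Q i.castSucc j.castSucc = Q i j := by
  have h : ∀ i : Fin n, finSumFinEquiv.symm (i.castSucc : Fin (n + 1)) = Sum.inl i := fun i =>
    finSumFinEquiv_symm_apply_castAdd i
  simp [directSumOne, h]

theorem directSumOne_castSucc_last (Q : Matrix (Fin n) (Fin n) ℝ) (i : Fin n) :
    directSumOne Q i.castSucc (Fin.last n) = 0 := by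
  have h : ∀ i : Fin n, finSumFinEquiv.symm (i.castSucc : Fin (n + 1)) = Sum.inl i := fun i =>
    finSumFinEquiv_symm_apply_castAdd i
  simp [directSumOne, h]

theorem directSumOne_last_castSucc (Q : Matrix (Fin n) (Fin n) ℝ) (j : Fin n) :
    directSumOne Q (Fin.last n) j.castSucc = 0 := by
  have h : ∀ i : Fin n, finSumFinEquiv.symm (i.castSucc : Fin (n + 1)) = Sum.inl i := fun i =>
    finSumFinEquiv_symm_apply_castAdd i
  simp [directSumOne, h]

theorem directSumOne_last_last (Q : Matrix (Fin n) (Fin n) ℝ) :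
    directSumOne Q (Fin.last n) (Fin.last n) = 1 := by
  simp [directSumOne]

theorem directSumOne_mul_transpose {Q : Matrix (Fin n) (Fin n) ℝ}
    (hQ : Q * Q.transpose = 1) : directSumOne Q * directSumOne Q.transpose = 1 := by
  simp only [directSumOne, Matrix.reindex_apply, Matrix.submatrix_mul_equiv,
    Matrix.fromBlocks_multiply, hQ]
  simp

theorem lorentzSpectrum_subset_conj {Q : Matrix (Fin n) (Fin n) ℝ}
    (hQ : Q.transpose * Q = 1) (A : Matrix (Fin (n + 1)) (Fin (n + 1)) ℝ) :
    lorentzSpectrum A ⊆ lorentzSpectrum (directSumOne Q * A * directSumOne Q.transpose) := by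
  have hB : blockB (directSumOne Q * A * directSumOne Q.transpose) =
      Q * blockB A * Q.transpose := by
    ext i j
    simp [blockB, Matrix.mul_apply, Fin.sum_univ_castSucc, directSumOne_castSucc_castSucc,
      directSumOne_castSucc_last, directSumOne_last_castSucc]
  have hU : blockU (directSumOne Q * A * directSumOne Q.transpose) = Q.mulVec (blockU A) := by
    ext i
    simp [blockU, Matrix.mul_apply, Fin.sum_univ_castSucc, directSumOne_castSucc_castSucc,
      directSumOne_castSucc_last, directSumOne_last_last, Matrix.mulVec, dotProduct]
  have hV : blockV (directSumOne Q * A * directSumOne Q.transpose) = Q.mulVec (blockV A) := by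
    ext i
    simp [blockV, Matrix.mul_apply, Fin.sum_univ_castSucc, directSumOne_castSucc_castSucc,
      directSumOne_last_castSucc, directSumOne_last_last, Matrix.mulVec, dotProduct, mul_comm]
  have hD : (directSumOne Q * A * directSumOne Q.transpose) (Fin.last n) (Fin.last n) =
      A (Fin.last n) (Fin.last n) := by
    simp [Matrix.mul_apply, Fin.sum_univ_castSucc, directSumOne_last_castSucc,
      directSumOne_castSucc_last, directSumOne_last_last]
  have hdot : ∀ x y : Fin n → ℝ, Q.mulVec x ⬝ᵥ Q.mulVec y = x ⬝ᵥ y := by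
    intro x y
    rw [Matrix.dotProduct_mulVec, ← Matrix.mulVec_transpose, Matrix.mulVec_mulVec, hQ,
      Matrix.one_mulVec]
  intro μ hμ
  rw [mem_lorentzSpectrum_iff] at hμ ⊢
  obtain ⟨ξ, s, h1, h2, h3, h4, h5⟩ := hμ
  refine ⟨Q.mulVec ξ, s, by rwa [hdot], h2, by rwa [hdot], ?_, by rwa [hV, hD, hdot]⟩
  rw [hB, hU, Matrix.mulVec_mulVec, Matrix.mul_assoc, hQ, Matrix.mul_one, ← Matrix.mulVec_mulVec,
    ← Matrix.mulVec_add, h4, Matrix.mulVec_smul]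

theorem lorentzSpectrum_conj {Q : Matrix (Fin n) (Fin n) ℝ}
    (hQ : Q.transpose * Q = 1) (A : Matrix (Fin (n + 1)) (Fin (n + 1)) ℝ) :
    lorentzSpectrum (directSumOne Q * A * directSumOne Q.transpose) = lorentzSpectrum A := by
  have hQ' : Q * Q.transpose = 1 := mul_eq_one_comm.1 hQ
  refine Set.Subset.antisymm ?_ (lorentzSpectrum_subset_conj hQ A)
  have h1 := lorentzSpectrum_subset_conj (Q := Q.transpose) (by simpa using hQ')
    (directSumOne Q * A * directSumOne Q.transpose)
  have h2 : directSumOne Q.transpose * directSumOne Q = 1 := by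
    simpa using directSumOne_mul_transpose (Q := Q.transpose) (by simpa using hQ)
  have h3 : directSumOne Q.transpose * (directSumOne Q * A * directSumOne Q.transpose) *
      directSumOne Q.transpose.transpose = A := by
    calc _ = (directSumOne Q.transpose * directSumOne Q) * A *
          (directSumOne Q.transpose * directSumOne Q) := by
          simp only [Matrix.transpose_transpose, Matrix.mul_assoc]
      _ = A := by rw [h2, Matrix.one_mul, Matrix.mul_one]
  rwa [h3] at h1

end Conjugation

/-! ### Matrices with infinite Lorentz spectrum -/

section Infinite

theorem mem_lorentzSpectrum_three_iff (A : Matrix (Fin 3) (Fin 3) ℝ) (μ : ℝ) :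
    μ ∈ lorentzSpectrum A ↔ ∃ x y s : ℝ, x ^ 2 + y ^ 2 ≤ 1 ∧ 0 ≤ s ∧
      s * (1 - (x ^ 2 + y ^ 2)) = 0 ∧ A 0 0 * x + A 0 1 * y + A 0 2 = (μ - s) * x ∧
      A 1 0 * x + A 1 1 * y + A 1 2 = (μ - s) * y ∧ A 2 0 * x + A 2 1 * y + A 2 2 = μ + s := by
  have key : ∀ (ξ : Fin 2 → ℝ) (s : ℝ), (ξ ⬝ᵥ ξ ≤ 1 ∧ 0 ≤ s ∧
      s * (1 - ξ ⬝ᵥ ξ) = 0 ∧ (blockB A).mulVec ξ + blockU A = (μ - s) • ξ ∧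
      blockV A ⬝ᵥ ξ + A (Fin.last 2) (Fin.last 2) = μ + s) ↔
      (ξ 0 ^ 2 + ξ 1 ^ 2 ≤ 1 ∧ 0 ≤ s ∧
      s * (1 - (ξ 0 ^ 2 + ξ 1 ^ 2)) = 0 ∧ A 0 0 * ξ 0 + A 0 1 * ξ 1 + A 0 2 = (μ - s) * ξ 0 ∧
      A 1 0 * ξ 0 + A 1 1 * ξ 1 + A 1 2 = (μ - s) * ξ 1 ∧
      A 2 0 * ξ 0 + A 2 1 * ξ 1 + A 2 2 = μ + s) := by
    intro ξ s
    have h1 : ξ ⬝ᵥ ξ = ξ 0 ^ 2 + ξ 1 ^ 2 := by simp [dotProduct, Fin.sum_univ_two, sq]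
    have h2 : (blockB A).mulVec ξ + blockU A = (μ - s) • ξ ↔
        A 0 0 * ξ 0 + A 0 1 * ξ 1 + A 0 2 = (μ - s) * ξ 0 ∧
        A 1 0 * ξ 0 + A 1 1 * ξ 1 + A 1 2 = (μ - s) * ξ 1 := by
      rw [funext_iff, Fin.forall_fin_two]
      simp [blockB, blockU, Fin.last]
    have h3 : blockV A ⬝ᵥ ξ + A (Fin.last 2) (Fin.last 2) =
        A 2 0 * ξ 0 + A 2 1 * ξ 1 + A 2 2 := by
      simp [dotProduct, Fin.sum_univ_two, blockV, Fin.last]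
    rw [h1, h2, h3, and_assoc]
  rw [mem_lorentzSpectrum_iff]
  constructor
  · rintro ⟨ξ, s, h⟩
    exact ⟨ξ 0, ξ 1, s, (key ξ s).1 h⟩
  · rintro ⟨x, y, s, h⟩
    exact ⟨![x, y], s, (key ![x, y] s).2 (by simpa using h)⟩

/-- The matrix `[b I, 0; vᵀ, d]` with `v = (p, q)`. -/
def bordered (b p q d : ℝ) : Matrix (Fin 3) (Fin 3) ℝ := !![b, 0, 0; 0, b, 0; p, q, d]

theorem bordered_add (b p q d b' p' q' d' : ℝ) :
    bordered b p q d + bordered b' p' q' d' = bordered (b + b') (p + p') (q + q') (d + d') := by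
  ext i j; fin_cases i <;> fin_cases j <;> simp [bordered]

theorem smul_bordered (c b p q d : ℝ) :
    c • bordered b p q d = bordered (c * b) (c * p) (c * q) (c * d) := by
  ext i j; fin_cases i <;> fin_cases j <;> simp [bordered]

theorem neg_bordered (b p q d : ℝ) :
    -bordered b p q d = bordered (-b) (-p) (-q) (-d) := by
  ext i j; fin_cases i <;> fin_cases j <;> simp [bordered]

theorem exists_unit_of_abs_le {p q t : ℝ} (h : |t| ≤ √(p ^ 2 + q ^ 2)) :
    ∃ x y : ℝ, x ^ 2 + y ^ 2 = 1 ∧ p * x + q * y = t := by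
  have h1 : t ^ 2 ≤ p ^ 2 + q ^ 2 := by
    have := sq_le_sq' (by linarith [abs_nonneg t, Real.sqrt_nonneg (p ^ 2 + q ^ 2)]) h
    rwa [sq_abs, Real.sq_sqrt (by positivity)] at this
  rcases eq_or_ne (p ^ 2 + q ^ 2) 0 with h0 | h0
  · have hp : p = 0 := by nlinarith [sq_nonneg p, sq_nonneg q]
    have hq : q = 0 := by nlinarith [sq_nonneg p, sq_nonneg q]
    have ht : t = 0 := by nlinarith [sq_nonneg t]
    exact ⟨1, 0, by norm_num, by rw [hp, hq, ht]; ring⟩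
  · set w := √(p ^ 2 + q ^ 2 - t ^ 2)
    have hw : w ^ 2 = p ^ 2 + q ^ 2 - t ^ 2 := Real.sq_sqrt (by linarith)
    refine ⟨(p * t - q * w) / (p ^ 2 + q ^ 2), (q * t + p * w) / (p ^ 2 + q ^ 2), ?_, ?_⟩
    · field_simp
      linear_combination (p ^ 2 + q ^ 2) * hw
    · field_simp
      ring

/-- The eigenvectors are `(0, 1)`, with eigenvalue `d`, and every `(ξ, 1)` with `‖ξ‖ = 1`, with
eigenvalue `(b + d + v ⬝ ξ) / 2`, for which this number is at least `b`; other eigenvectors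
contribute no further eigenvalue. -/
theorem mem_lorentzSpectrum_bordered_iff (b p q d μ : ℝ) :
    μ ∈ lorentzSpectrum (bordered b p q d) ↔
      μ = d ∨ (b ≤ μ ∧ |2 * μ - b - d| ≤ √(p ^ 2 + q ^ 2)) := by
  rw [mem_lorentzSpectrum_three_iff]
  simp only [bordered, Matrix.of_apply, Matrix.cons_val', Matrix.cons_val_zero, Matrix.cons_val_one,
    Matrix.cons_val, zero_mul, add_zero, zero_add]
  constructor
  · rintro ⟨x, y, s, h1, h2, h3, h4, h5, h6⟩
    by_cases h : μ - s = b
    · right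
      refine ⟨by linarith, Real.abs_le_sqrt ?_⟩
      have h7 : 2 * μ - b - d = p * x + q * y := by linarith
      rw [h7]
      nlinarith [sq_nonneg (p * y - q * x), sq_nonneg p, sq_nonneg q]
    · left
      have hx : x = 0 := by
        have : (μ - s - b) * x = 0 := by linarith
        exact (mul_eq_zero.1 this).resolve_left (sub_ne_zero.2 h)
      have hy : y = 0 := by
        have : (μ - s - b) * y = 0 := by linarith
        exact (mul_eq_zero.1 this).resolve_left (sub_ne_zero.2 h)
      subst hx hy
      norm_num at h3
      subst h3
      linarith
  · rintro (h | ⟨h1, h2⟩)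
    · exact ⟨0, 0, 0, by norm_num, le_rfl, by ring, by ring, by ring, by rw [h]; ring⟩
    · obtain ⟨x, y, hxy, ht⟩ := exists_unit_of_abs_le h2
      exact ⟨x, y, μ - b, hxy.le, by linarith, by rw [hxy]; ring, by ring, by ring, by linarith⟩

/-- The first coordinates `x` of the points of the unit circle where
`(B ξ + u) ∧ ξ = 0` satisfy a quartic equation, which is trivial only for `B = b I`, `u = 0`. -/
theorem finite_circle_solutions {α β γ δ ε : ℝ}
    (h : ¬ (α = 0 ∧ β = 0 ∧ γ = 0 ∧ δ = 0 ∧ ε = 0)) :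
    {z : ℝ × ℝ | z.1 ^ 2 + z.2 ^ 2 = 1 ∧
      α * z.1 ^ 2 + γ * z.1 + δ + z.2 * (β * z.1 + ε) = 0}.Finite := by
  open Polynomial in
  set P : Polynomial ℝ := (C α * X ^ 2 + C γ * X + C δ) ^ 2 - (1 - X ^ 2) * (C β * X + C ε) ^ 2
    with hP
  have heval : ∀ x : ℝ, P.eval x =
      (α * x ^ 2 + γ * x + δ) ^ 2 - (1 - x ^ 2) * (β * x + ε) ^ 2 := by
    intro x; simp [hP]
  have hP0 : P ≠ 0 := by
    intro h0
    have e : ∀ x : ℝ, (α * x ^ 2 + γ * x + δ) ^ 2 - (1 - x ^ 2) * (β * x + ε) ^ 2 = 0 := by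
      intro x; rw [← heval, h0, Polynomial.eval_zero]
    have e1 : α + γ + δ = 0 := by
      have := e 1
      norm_num at this
      exact this
    have e2 : α - γ + δ = 0 := by
      have := e (-1)
      norm_num at this
      linarith
    -- For `|x| > 1` the identity is a sum of two squares with positive coefficients.
    have e3 := e 2
    have e4 := e (-2)
    have e5 : 2 * β + ε = 0 := by
      nlinarith [sq_nonneg (α * 2 ^ 2 + γ * 2 + δ), sq_nonneg (2 * β + ε)]
    have e6 : 4 * α + 2 * γ + δ = 0 := by
      nlinarith [sq_nonneg (4 * α + 2 * γ + δ), sq_nonneg (2 * β + ε)]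
    have e7 : -2 * β + ε = 0 := by
      nlinarith [sq_nonneg (4 * α - 2 * γ + δ), sq_nonneg (-2 * β + ε)]
    exact h ⟨by linarith, by linarith, by linarith, by linarith, by linarith⟩
  have hroots : {x : ℝ | P.IsRoot x}.Finite := Polynomial.finite_setOfPred_isRoot hP0
  refine ((hroots.image fun x => (x, √(1 - x ^ 2))).union
    (hroots.image fun x => (x, -√(1 - x ^ 2)))).subset ?_
  rintro ⟨x, y⟩ ⟨h1, h2⟩
  simp only at h1 h2
  have hx : P.IsRoot x := by
    rw [Polynomial.IsRoot, heval]
    linear_combination (α * x ^ 2 + γ * x + δ - y * (β * x + ε)) * h2 + (β * x + ε) ^ 2 * h1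
  have hy : 1 - x ^ 2 = y ^ 2 := by linarith
  rcases le_total 0 y with h0 | h0
  · left
    exact ⟨x, hx, by simp only [hy, Real.sqrt_sq h0]⟩
  · right
    refine ⟨x, hx, ?_⟩
    simp only [hy, Real.sqrt_sq_eq_abs, abs_of_nonpos h0, neg_neg]

/-- Eigenvectors inside the cone give roots of the characteristic polynomial, so an infinite
spectrum needs infinitely many boundary eigenvectors. -/
theorem eq_bordered_of_infinite_lorentzSpectrum {A : Matrix (Fin 3) (Fin 3) ℝ}
    (hA : (lorentzSpectrum A).Infinite) : ∃ b p q d : ℝ, A = bordered b p q d := by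
  by_cases h : -(A 1 0 + A 0 1) = 0 ∧ A 0 0 - A 1 1 = 0 ∧ -A 1 2 = 0 ∧ A 0 1 = 0 ∧ A 0 2 = 0
  · obtain ⟨h1, h2, h3, h4, h5⟩ := h
    refine ⟨A 0 0, A 2 0, A 2 1, A 2 2, ?_⟩
    ext i j
    fin_cases i <;> fin_cases j <;> simp [bordered] <;> linarith
  · exfalso
    apply hA
    refine (((finite_circle_solutions h).image fun z : ℝ × ℝ =>
      (z.1 * (A 0 0 * z.1 + A 0 1 * z.2 + A 0 2) + z.2 * (A 1 0 * z.1 + A 1 1 * z.2 + A 1 2) +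
        (A 2 0 * z.1 + A 2 1 * z.2 + A 2 2)) / 2).union
      (Polynomial.finite_setOfPred_isRoot (Matrix.charpoly_monic A).ne_zero)).subset ?_
    intro μ hμ
    obtain ⟨x, y, s, h1, h2, h3, h4, h5, h6⟩ := (mem_lorentzSpectrum_three_iff A μ).1 hμ
    rcases mul_eq_zero.1 h3 with hs | hs
    · right
      subst hs
      have hdet : (Matrix.scalar (Fin 3) μ - A).det = 0 := by
        rw [← Matrix.exists_mulVec_eq_zero_iff]
        refine ⟨![x, y, 1], fun h0 => ?_, ?_⟩
        · simpa using congrFun h0 2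
        · ext i
          fin_cases i <;>
            simp [Matrix.mulVec, dotProduct, Fin.sum_univ_three] <;> linarith
      simpa [Polynomial.IsRoot, Matrix.eval_charpoly] using hdet
    · left
      refine ⟨(x, y), ⟨by simp only; linarith, ?_⟩, ?_⟩
      · simp only
        linear_combination y * h4 - x * h5 + A 0 1 * hs
      · simp only
        rw [h4, h5, h6]
        linear_combination (-(μ - s) / 2) * hs

end Infinite

/-! ### Linear preservers -/

section Preservers

theorem infinite_lorentzSpectrum_bordered {p q : ℝ} (d : ℝ) (hd : 0 ≤ d)
    (h : d < √(p ^ 2 + q ^ 2)) : (lorentzSpectrum (bordered 0 p q d)).Infinite := by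
  refine (Set.Icc_infinite (a := d / 2) (b := (d + √(p ^ 2 + q ^ 2)) / 2)
    (by linarith)).mono ?_
  rintro x ⟨h1, h2⟩
  rw [mem_lorentzSpectrum_bordered_iff]
  right
  refine ⟨by linarith, abs_le.2 ⟨?_, ?_⟩⟩ <;> linarith

/-- The spectrum of `[0, 0; v'ᵀ, 0]` is the interval `[0, ‖v'‖ / 2]`; sharing it with both signs
fixes `b`, `d` and the norm of `v`. -/
theorem bordered_isometry {b p q d p' q' : ℝ} (h0 : 0 < p' ^ 2 + q' ^ 2)
    (h1 : lorentzSpectrum (bordered b p q d) = lorentzSpectrum (bordered 0 p' q' 0))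
    (h2 : lorentzSpectrum (-bordered b p q d) = lorentzSpectrum (-bordered 0 p' q' 0)) :
    b = 0 ∧ d = 0 ∧ p ^ 2 + q ^ 2 = p' ^ 2 + q' ^ 2 := by
  simp only [neg_bordered, Set.ext_iff, mem_lorentzSpectrum_bordered_iff, neg_zero,
    neg_sq] at h1 h2
  set r := √(p ^ 2 + q ^ 2) with hr
  set r' := √(p' ^ 2 + q' ^ 2) with hr'
  have hr'0 : 0 < r' := Real.sqrt_pos.2 h0
  have hr0 : 0 ≤ r := Real.sqrt_nonneg _
  have hd : d = 0 := by
    rcases (h1 d).1 (Or.inl rfl) with h | ⟨h, -⟩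
    · exact h
    · rcases (h2 (-d)).1 (Or.inl rfl) with h' | ⟨h', -⟩ <;> linarith
  subst hd
  -- The right end point `r' / 2` of both spectra gives `r' + |b| ≤ r`.
  have e1 : r' / 2 = 0 ∨ (b ≤ r' / 2 ∧ |2 * (r' / 2) - b - 0| ≤ r) :=
    (h1 (r' / 2)).2 (Or.inr ⟨by linarith, le_of_eq (by
      rw [mul_div_cancel₀ _ two_ne_zero, sub_zero, sub_zero, abs_of_pos hr'0])⟩)
  have e2 : r' / 2 = -0 ∨ (-b ≤ r' / 2 ∧ |2 * (r' / 2) - -b - -0| ≤ r) :=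
    (h2 (r' / 2)).2 (Or.inr ⟨by linarith, le_of_eq (by
      rw [mul_div_cancel₀ _ two_ne_zero, sub_zero, sub_zero, abs_of_pos hr'0])⟩)
  have e1 := e1.resolve_left (by linarith)
  have e2 := e2.resolve_left (by linarith)
  have f1 := (abs_le.1 e1.2).2
  have f2 := (abs_le.1 e2.2).2
  -- The right end points `(r ± b) / 2` give `r + |b| ≤ r'`.
  have g1 : r + b ≤ r' := by
    rcases (h1 ((r + b) / 2)).1 (Or.inr ⟨by linarith, le_of_eq (by
      rw [mul_div_cancel₀ _ two_ne_zero, sub_zero, add_sub_cancel_right, abs_of_nonneg hr0])⟩) with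
      h | ⟨-, h⟩
    · linarith
    · linarith [(abs_le.1 h).2]
  have g2 : r - b ≤ r' := by
    rcases (h2 ((r - b) / 2)).1 (Or.inr ⟨by linarith, le_of_eq (by
      rw [mul_div_cancel₀ _ two_ne_zero, neg_zero, sub_zero, sub_neg_eq_add, sub_add_cancel,
        abs_of_nonneg hr0])⟩) with h | ⟨-, h⟩
    · linarith
    · linarith [(abs_le.1 h).2]
  have hb : b = 0 := by linarith
  refine ⟨hb, rfl, ?_⟩
  have hrr : r = r' := by linarith
  have i1 : r ^ 2 = p ^ 2 + q ^ 2 := Real.sq_sqrt (by positivity)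
  have i2 : r' ^ 2 = p' ^ 2 + q' ^ 2 := Real.sq_sqrt (by positivity)
  rw [← i1, ← i2, hrr]

/-- The corner matrix `E = [0, 0; 0, 1]` has the spectrum `{1/2, 1}`, and `-E` has `{-1}`; among
the matrices `[b I, 0; vᵀ, d]` these two spectra characterize it. -/
theorem bordered_corner {b p q d : ℝ}
    (h1 : lorentzSpectrum (bordered b p q d) = lorentzSpectrum (bordered 0 0 0 1))
    (h2 : lorentzSpectrum (-bordered b p q d) = lorentzSpectrum (-bordered 0 0 0 1)) :
    bordered b p q d = bordered 0 0 0 1 := by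
  simp only [neg_bordered, Set.ext_iff, mem_lorentzSpectrum_bordered_iff, neg_zero,
    neg_sq] at h1 h2
  have hsq : √((0 : ℝ) ^ 2 + 0 ^ 2) = 0 := by simp
  rw [hsq] at h1 h2
  set r := √(p ^ 2 + q ^ 2) with hr
  have hr0 : 0 ≤ r := Real.sqrt_nonneg _
  have hd : d = 1 := by
    rcases (h2 (-d)).1 (Or.inl rfl) with h | ⟨h, h'⟩
    · linarith
    · linarith [(abs_le.1 h').2]
  subst hd
  have h1' : ∀ x : ℝ, b ≤ x → |2 * x - b - 1| ≤ r → x = 1 ∨ x = 1 / 2 := by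
    intro x hx hx'
    rcases (h1 x).1 (Or.inr ⟨hx, hx'⟩) with h | ⟨-, h⟩
    · exact Or.inl h
    · right; linarith [(abs_le.1 h).1, (abs_le.1 h).2]
  obtain ⟨hb, hbr⟩ : b ≤ 1 / 2 ∧ |2 * (1 / 2) - b - 1| ≤ r := by
    have := (h1 (1 / 2)).2 (Or.inr ⟨by norm_num, by norm_num⟩)
    exact this.resolve_left (by norm_num)
  have hbr' := abs_le.1 hbr
  -- The spectrum contains the interval from `1/2` to `(1 + b + r) / 2`, so the latter is `1/2`.
  have hbr0 : b + r = 0 := by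
    rcases h1' ((1 + b + r) / 2) (by linarith) (abs_le.2 ⟨by linarith, by linarith⟩) with h | h
    · exfalso
      have := h1' (3 / 4) (by linarith) (abs_le.2 ⟨by linarith, by linarith⟩)
      norm_num at this
    · linarith
  have hb0 : b = 0 := by
    rcases h1' (1 / 2 + b) (by linarith) (abs_le.2 ⟨by linarith, by linarith⟩) with h | h <;>
      linarith
  have hr00 : r = 0 := by linarith
  have hpq : p ^ 2 + q ^ 2 = 0 := (Real.sqrt_eq_zero (by positivity)).1 hr00
  have hp : p = 0 := by nlinarith [sq_nonneg p, sq_nonneg q]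
  have hq : q = 0 := by nlinarith [sq_nonneg p, sq_nonneg q]
  rw [hb0, hp, hq]

/-- The matrix `[0, 0; vᵀ, 0]` with `v ≠ 0` has infinite spectrum, and so has its image. -/
theorem exists_row_image {φ : Matrix (Fin 3) (Fin 3) ℝ →ₗ[ℝ] Matrix (Fin 3) (Fin 3) ℝ}
    (hφ : PreservesLorentzSpectrum φ) {p q : ℝ} (h : 0 < p ^ 2 + q ^ 2) :
    ∃ p' q' : ℝ, φ (bordered 0 p q 0) = bordered 0 p' q' 0 ∧ p' ^ 2 + q' ^ 2 = p ^ 2 + q ^ 2 := by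
  have h1 := hφ (bordered 0 p q 0)
  have h2 := hφ (-bordered 0 p q 0)
  have hinf := infinite_lorentzSpectrum_bordered 0 le_rfl (Real.sqrt_pos.2 h)
  rw [← h1] at hinf
  obtain ⟨b, p', q', d, he⟩ := eq_bordered_of_infinite_lorentzSpectrum hinf
  rw [map_neg] at h2
  rw [he] at h1 h2
  obtain ⟨hb, hd, hn⟩ := bordered_isometry h h1 h2
  exact ⟨p', q', by rw [he, hb, hd], hn⟩

/-- The corner matrix `E` is a difference of two matrices with infinite spectrum, so its image has
the form `[b I, 0; vᵀ, d]`. -/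
theorem map_corner {φ : Matrix (Fin 3) (Fin 3) ℝ →ₗ[ℝ] Matrix (Fin 3) (Fin 3) ℝ}
    (hφ : PreservesLorentzSpectrum φ) : φ (bordered 0 0 0 1) = bordered 0 0 0 1 := by
  obtain ⟨p', q', he, -⟩ := exists_row_image hφ (p := 2) (q := 0) (by norm_num)
  have hinf : (lorentzSpectrum (bordered 0 2 0 1)).Infinite := by
    refine infinite_lorentzSpectrum_bordered 1 zero_le_one ?_
    rw [Real.lt_sqrt zero_le_one]
    norm_num
  rw [← hφ] at hinf
  obtain ⟨b, p, q, d, he'⟩ := eq_bordered_of_infinite_lorentzSpectrum hinf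
  have hsplit : bordered 0 0 0 1 = bordered 0 2 0 1 + (-1 : ℝ) • bordered 0 2 0 0 := by
    rw [smul_bordered, bordered_add]; norm_num
  have himg : φ (bordered 0 0 0 1) = bordered b (p - p') (q - q') d := by
    rw [hsplit, map_add, map_smul, he, he', smul_bordered, bordered_add]
    congr 1 <;> ring
  have h1 := hφ (bordered 0 0 0 1)
  have h2 := hφ (-bordered 0 0 0 1)
  rw [map_neg] at h2
  rw [himg] at h1 h2 ⊢
  exact bordered_corner h1 h2

/-- If the column `u` of `A` is cyclic for `B`, that is, if `u` and `B u` are linearly independent,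
then the vectors `Bᵏ u` and the numbers `v ⬝ Bᵏ u` for `k ≤ 2` determine `B`, `u` and `v`. -/
theorem map_eq_self_of_cyclic
    {ψ : Matrix (Fin 3) (Fin 3) ℝ →ₗ[ℝ] Matrix (Fin 3) (Fin 3) ℝ}
    (hψ : PreservesLorentzSpectrum ψ) (hrow : ∀ p q : ℝ, ψ (bordered 0 p q 0) = bordered 0 p q 0)
    (A : Matrix (Fin 3) (Fin 3) ℝ)
    (hA : A 0 2 * (A 1 0 * A 0 2 + A 1 1 * A 1 2) - A 1 2 * (A 0 0 * A 0 2 + A 0 1 * A 1 2) ≠ 0) :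
    ψ A = A := by
  have hE : (Matrix.single (Fin.last 2) (Fin.last 2) 1 : Matrix (Fin 3) (Fin 3) ℝ) =
      bordered 0 0 0 1 := by
    ext i j; fin_cases i <;> fin_cases j <;> simp [bordered, Fin.last]
  set A' := ψ A with hA'
  have key : ∀ p q : ℝ, (A + bordered 0 p q 0) 2 2 = (A' + bordered 0 p q 0) 2 2 ∧ ∀ k : ℕ,
      blockV (A + bordered 0 p q 0) ⬝ᵥ (blockB A ^ k).mulVec (blockU A) =
      blockV (A' + bordered 0 p q 0) ⬝ᵥ (blockB A' ^ k).mulVec (blockU A') := by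
    intro p q
    have hB : ∀ A : Matrix (Fin 3) (Fin 3) ℝ, blockB (A + bordered 0 p q 0) = blockB A := by
      intro A; ext i j; fin_cases i <;> fin_cases j <;> simp [blockB, bordered]
    have hU : ∀ A : Matrix (Fin 3) (Fin 3) ℝ, blockU (A + bordered 0 p q 0) = blockU A := by
      intro A; ext i; fin_cases i <;> simp [blockU, bordered, Fin.last]
    have h := markov_eq_of_lorentzSpectrum_subset (A := A + bordered 0 p q 0)
      (A' := A' + bordered 0 p q 0) (fun t => by
        rw [← hψ, map_add, map_add, map_smul, hrow, hE, map_corner hψ])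
    rw [hB, hB, hU, hU] at h
    exact h
  have hv : ∀ (p q : ℝ) (A : Matrix (Fin 3) (Fin 3) ℝ) (x : Fin 2 → ℝ),
      blockV (A + bordered 0 p q 0) ⬝ᵥ x = (A 2 0 + p) * x 0 + (A 2 1 + q) * x 1 := by
    intro p q A x
    simp [dotProduct, Fin.sum_univ_two, blockV, bordered, Fin.last]
  simp only [hv] at key
  have hd : A 2 2 = A' 2 2 := by
    simpa [bordered] using (key 0 0).1
  have hpow : ∀ k : ℕ, (blockB A ^ k).mulVec (blockU A) 0 = (blockB A' ^ k).mulVec (blockU A') 0 ∧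
      (blockB A ^ k).mulVec (blockU A) 1 = (blockB A' ^ k).mulVec (blockU A') 1 ∧
      (A 2 0 - A' 2 0) * (blockB A ^ k).mulVec (blockU A) 0 +
        (A 2 1 - A' 2 1) * (blockB A ^ k).mulVec (blockU A) 1 = 0 := by
    intro k
    have h1 := (key 0 0).2 k
    have h2 := (key 1 0).2 k
    have h3 := (key 0 1).2 k
    have e1 : (blockB A ^ k).mulVec (blockU A) 0 = (blockB A' ^ k).mulVec (blockU A') 0 := by
      linarith
    have e2 : (blockB A ^ k).mulVec (blockU A) 1 = (blockB A' ^ k).mulVec (blockU A') 1 := by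
      linarith
    refine ⟨e1, e2, ?_⟩
    rw [← e1, ← e2] at h1
    linarith
  have hB : ∀ (A : Matrix (Fin 3) (Fin 3) ℝ) (x : Fin 2 → ℝ),
      (blockB A).mulVec x = ![A 0 0 * x 0 + A 0 1 * x 1, A 1 0 * x 0 + A 1 1 * x 1] := by
    intro A x
    ext i
    fin_cases i <;> simp [Matrix.mulVec, dotProduct, Fin.sum_univ_two, blockB]
  have hU : ∀ A : Matrix (Fin 3) (Fin 3) ℝ, blockU A = ![A 0 2, A 1 2] := by
    intro A; ext i; fin_cases i <;> simp [blockU, Fin.last]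
  have k0 := hpow 0
  have k1 := hpow 1
  have k2 := hpow 2
  simp only [pow_zero, Matrix.one_mulVec, pow_one, sq, ← Matrix.mulVec_mulVec, hB, hU,
    Matrix.cons_val_zero, Matrix.cons_val_one] at k0 k1 k2
  obtain ⟨a0, b0, c0⟩ := k0
  obtain ⟨a1, b1, c1⟩ := k1
  obtain ⟨a2, b2, -⟩ := k2
  rw [← a1, ← b1] at a2 b2
  rw [← a0, ← b0] at a1 b1
  have hind : ∀ s t : ℝ, s * A 0 2 + t * A 1 2 = 0 →
      s * (A 0 0 * A 0 2 + A 0 1 * A 1 2) + t * (A 1 0 * A 0 2 + A 1 1 * A 1 2) = 0 →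
      s = 0 ∧ t = 0 := by
    intro s t h1 h2
    constructor
    · refine (mul_eq_zero.1 ?_).resolve_right hA
      linear_combination (A 1 0 * A 0 2 + A 1 1 * A 1 2) * h1 - A 1 2 * h2
    · refine (mul_eq_zero.1 ?_).resolve_right hA
      linear_combination A 0 2 * h2 - (A 0 0 * A 0 2 + A 0 1 * A 1 2) * h1
  obtain ⟨d1, d2⟩ := hind (A 0 0 - A' 0 0) (A 0 1 - A' 0 1) (by linarith) (by linarith)
  obtain ⟨d3, d4⟩ := hind (A 1 0 - A' 1 0) (A 1 1 - A' 1 1) (by linarith) (by linarith)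
  obtain ⟨d5, d6⟩ := hind _ _ c0 c1
  ext i j
  fin_cases i <;> fin_cases j <;> simp <;> linarith

/-- On a line `A + s C` with `C` cyclic, the cyclicity determinant is a cubic in `s`, so the
cyclic matrices span the whole space. -/
theorem map_eq_self_of_map_row_eq
    {ψ : Matrix (Fin 3) (Fin 3) ℝ →ₗ[ℝ] Matrix (Fin 3) (Fin 3) ℝ}
    (hψ : PreservesLorentzSpectrum ψ) (hrow : ∀ p q : ℝ, ψ (bordered 0 p q 0) = bordered 0 p q 0)
    (A : Matrix (Fin 3) (Fin 3) ℝ) : ψ A = A := by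
  -- The block and the column of `C` satisfy `u = (1, 0)` and `B u = (0, 1)`.
  set C : Matrix (Fin 3) (Fin 3) ℝ := !![0, 0, 1; 1, 0, 0; 0, 0, 0] with hC
  have hψC : ψ C = C := map_eq_self_of_cyclic hψ hrow C (by simp [hC])
  by_contra hne
  have hall : ∀ s : ℝ, (A 0 2 + s) * ((A 1 0 + s) * (A 0 2 + s) + A 1 1 * A 1 2) -
      A 1 2 * (A 0 0 * (A 0 2 + s) + A 0 1 * A 1 2) = 0 := by
    intro s
    by_contra hs
    apply hne
    have h := map_eq_self_of_cyclic hψ hrow (A + s • C) (by simpa [hC] using hs)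
    rw [map_add, map_smul, hψC] at h
    exact add_right_cancel h
  -- The third difference of a monic cubic is `6`.
  linarith [hall 0, hall 1, hall 2, hall 3]

end Preservers

theorem mainTheorem1
    (φ : Matrix (Fin 3) (Fin 3) ℝ →ₗ[ℝ] Matrix (Fin 3) (Fin 3) ℝ) :
    PreservesLorentzSpectrum φ ↔
      ∃ Q ∈ Matrix.orthogonalGroup (Fin 2) ℝ,
        ∀ A : Matrix (Fin 3) (Fin 3) ℝ, φ A = directSumOne Q * A * directSumOne Q.transpose := by
  constructor
  · intro hφ
    obtain ⟨a, c, h1, n1⟩ := exists_row_image hφ (p := 1) (q := 0) (by norm_num)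
    obtain ⟨b, d, h2, n2⟩ := exists_row_image hφ (p := 0) (q := 1) (by norm_num)
    obtain ⟨e, f, h3, n3⟩ := exists_row_image hφ (p := 1) (q := 1) (by norm_num)
    have hrow : ∀ p q : ℝ, φ (bordered 0 p q 0) = bordered 0 (p * a + q * b) (p * c + q * d) 0 := by
      intro p q
      have : bordered 0 p q 0 = p • bordered 0 1 0 0 + q • bordered 0 0 1 0 := by
        rw [smul_bordered, smul_bordered, bordered_add]; norm_num
      rw [this, map_add, map_smul, map_smul, h1, h2, smul_bordered, smul_bordered, bordered_add]
      norm_num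
    rw [hrow] at h3
    have he : 1 * a + 1 * b = e := by
      simpa [bordered] using congrFun (congrFun h3 2) 0
    have hf : 1 * c + 1 * d = f := by
      simpa [bordered] using congrFun (congrFun h3 2) 1
    -- Polarization: the norms of `Q (1, 0)`, `Q (0, 1)` and `Q (1, 1)` determine `Qᵀ Q`.
    have n4 : a * b + c * d = 0 := by
      rw [← he, ← hf] at n3
      linear_combination (n3 - n1 - n2) / 2
    set Q : Matrix (Fin 2) (Fin 2) ℝ := !![a, b; c, d] with hQ
    have hQQ : Q.transpose * Q = 1 := by
      ext i j
      fin_cases i <;> fin_cases j <;> simp [hQ, Matrix.mul_apply, Fin.sum_univ_two] <;> linarith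
    have hQQ' : Q * Q.transpose = 1 := mul_eq_one_comm.1 hQQ
    have hP : directSumOne Q * directSumOne Q.transpose = 1 := directSumOne_mul_transpose hQQ'
    have hP' : directSumOne Q.transpose * directSumOne Q = 1 := mul_eq_one_comm.1 hP
    -- Conjugation by `Qᵀ ⊕ 1` leaves a preserver that fixes all `[0, 0; vᵀ, 0]`.
    set ψ : Matrix (Fin 3) (Fin 3) ℝ →ₗ[ℝ] Matrix (Fin 3) (Fin 3) ℝ :=
      LinearMap.mulLeft ℝ (directSumOne Q.transpose) ∘ₗ LinearMap.mulRight ℝ (directSumOne Q) ∘ₗ φ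
      with hψ
    have hψA : ∀ A, ψ A = directSumOne Q.transpose * φ A * directSumOne Q := by
      intro A
      simp [hψ, Matrix.mul_assoc]
    have hψp : PreservesLorentzSpectrum ψ := by
      intro A
      have := lorentzSpectrum_conj (Q := Q.transpose) (by simpa using hQQ') (φ A)
      rw [Matrix.transpose_transpose] at this
      rw [hψA, this, hφ]
    have hψrow : ∀ p q : ℝ, ψ (bordered 0 p q 0) = bordered 0 p q 0 := by
      have hrowQ : ∀ p q : ℝ, directSumOne Q * bordered 0 p q 0 * directSumOne Q.transpose =
          bordered 0 (p * a + q * b) (p * c + q * d) 0 := by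
        intro p q
        have hdir : ∀ R : Matrix (Fin 2) (Fin 2) ℝ,
            directSumOne R = !![R 0 0, R 0 1, 0; R 1 0, R 1 1, 0; 0, 0, 1] := by
          intro R
          ext i j
          refine Fin.lastCases ?_ (fun i => ?_) i <;> refine Fin.lastCases ?_ (fun j => ?_) j
          · exact directSumOne_last_last R
          · rw [directSumOne_last_castSucc]; fin_cases j <;> rfl
          · rw [directSumOne_castSucc_last]; fin_cases i <;> rfl
          · rw [directSumOne_castSucc_castSucc]; fin_cases i <;> fin_cases j <;> rfl
        rw [hdir, hdir]
        ext i j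
        fin_cases i <;> fin_cases j <;>
          simp [bordered, hQ, Matrix.mul_apply, Fin.sum_univ_three]
      intro p q
      rw [hψA, hrow, ← hrowQ]
      calc _ = (directSumOne Q.transpose * directSumOne Q) * bordered 0 p q 0 *
            (directSumOne Q.transpose * directSumOne Q) := by simp only [Matrix.mul_assoc]
        _ = _ := by rw [hP', Matrix.one_mul, Matrix.mul_one]
    refine ⟨Q, (Matrix.mem_orthogonalGroup_iff' _ _).2 (by simpa using hQQ), fun A => ?_⟩
    have h := map_eq_self_of_map_row_eq hψp hψrow A
    calc φ A = (directSumOne Q * directSumOne Q.transpose) * φ A *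
          (directSumOne Q * directSumOne Q.transpose) := by
          rw [hP, Matrix.one_mul, Matrix.mul_one]
      _ = directSumOne Q * (directSumOne Q.transpose * φ A * directSumOne Q) *
          directSumOne Q.transpose := by simp only [Matrix.mul_assoc]
      _ = directSumOne Q * A * directSumOne Q.transpose := by rw [← hψA, h]
  · rintro ⟨Q, hQ, h⟩ A
    rw [h]
    exact lorentzSpectrum_conj (by simpa using (Matrix.mem_orthogonalGroup_iff' _ _).1 hQ) A
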